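/- Let $s(n,k)$ denote the (signed) Stirling numbers of the first kind, defined by $z(z-1)\cdots(z-n+1)=\sum_{k=0}^{n}s(n,k)z^{k}$; let $H_n=\sum_{i=1}^{n}\frac1i$ and $H_n^{(2)}=\sum_{i=1}^{n}\frac1{i^2}$ (with $H_0=H_0^{(2)}=0$); let $\zeta$ be the Riemann zeta function; and for integers $l\ge 1$, $r\ge1$ let $$S(-l,r)=\frac{(-1)^r}{r!}\sum_{j=1}^{r}\binom{r}{j}\frac{(-1)^j}{j^{l}} .$$ Then for all integers $r\ge 1$ and $m\ge 1$ the following series converges (absolutely), with sum $$\sum_{n=m}^{\infty}\frac{(-1)^{n-m}\,s(n,m)\left[\left(H_{n+r}-H_{r-1}\right)^2-\left(H^{(2)}_{n+r}-H^{(2)}_{r-1}\right)\right]}{2\,(n+1)!}=\frac1r\sum_{k=0}^{m-1}A_k(r)\,\zeta(m-k+1),$$ where $$A_k(r)=1+(-1)^{r+1}\,r!\sum_{l=1}^{k}S(-l,r).$$ -/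

import Mathlib

/-- Signed Stirling numbers of the first kind, defined by
`z (z - 1) ⋯ (z - n + 1) = ∑ k, s(n, k) z ^ k`. -/
noncomputable def stirlingFirstSigned (n k : ℕ) : ℤ :=
  (descPochhammer ℤ n).coeff k

/-- Generalized harmonic numbers `H_n^{(p)} = ∑_{i=1}^n 1 / i ^ p`. -/
noncomputable def genHarmonic (p n : ℕ) : ℝ :=
  ∑ i ∈ Finset.Icc 1 n, 1 / (i : ℝ) ^ p

/-- Stirling numbers of the second kind with a negative first argument:
`stirlingSecondNeg l r` is
`S(-l, r) = ((-1) ^ r / r!) ∑_{j=1}^r (r choose j) (-1) ^ j / j ^ l`. -/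
noncomputable def stirlingSecondNeg (l r : ℕ) : ℝ :=
  (-1) ^ r / (r.factorial : ℝ) *
    ∑ j ∈ Finset.Icc 1 r, (r.choose j : ℝ) * ((-1) ^ j / (j : ℝ) ^ l)

/-- The coefficients `A_k(r) = 1 + (-1) ^ (r + 1) r! ∑_{l=1}^k S(-l, r)`. -/
noncomputable def coeffA (k r : ℕ) : ℝ :=
  1 + (-1) ^ (r + 1) * (r.factorial : ℝ) * ∑ l ∈ Finset.Icc 1 k, stirlingSecondNeg l r

/-- The `n`-th summand of the series (for `n ≥ m`):
`(-1) ^ (n - m) s(n, m) [(H_{n+r} - H_{r-1})² - (H_{n+r}^{(2)} - H_{r-1}^{(2)})] / (2 (n + 1)!)`. -/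
noncomputable def stirlingHarmonicTerm (r m n : ℕ) : ℝ :=
  (-1) ^ (n - m) * (stirlingFirstSigned n m : ℝ) *
    ((genHarmonic 1 (n + r) - genHarmonic 1 (r - 1)) ^ 2
      - (genHarmonic 2 (n + r) - genHarmonic 2 (r - 1)))
    / (2 * ((n + 1).factorial : ℝ))

open Filter Topology Finset

/-! With the signs cancelled, the summand is `pairTerm`: c(n,m)/(n+1)! times e₂(1/r, …, 1/(r+n)),
which is nonnegative, so limits of partial sums suffice. The recurrence c(k+1,m+1) = k c(k,m+1) +
c(k,m) makes summation by parts lower m. Write P and T for the sums of `pairTerm` and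
`harmonicTerm`. Then P(r,m+1) = P(r,m) + T(r,m+1), (r+1) T(r+1,m+1) = T(r+1,m) + r T(r,m+1), and
T(1,m+1) = T(1,m) + ζ(m+2). The zeta value is ∑ c(k,m)/(k! k) = ζ(m+1), obtained from a double
series of reciprocal binomials. Boundary terms vanish because c(k,m)/k! is O(k^(-1/2)) and the
harmonic factors grow at most like log². The closed forms satisfy the same recurrences:
`alternatingCoeff` obeys a Pascal-type rule, and A_k(r) is its partial sum over 0, …, k. -/

/-! ### Normalised Stirling numbers and their decay -/

/-- The unsigned Stirling numbers of the first kind divided by a factorial: the coefficient of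
`x ^ m` in `x (x + 1) ⋯ (x + k - 1) / k!`. -/
noncomputable def normStirling (m k : ℕ) : ℝ :=
  (Nat.stirlingFirst k m : ℝ) / (k.factorial : ℝ)

lemma normStirling_nonneg (m k : ℕ) : 0 ≤ normStirling m k := by
  unfold normStirling; positivity

lemma normStirling_succ_zero (m : ℕ) : normStirling (m + 1) 0 = 0 := by
  simp [normStirling]

lemma normStirling_zero_zero : normStirling 0 0 = 1 := by
  simp [normStirling]

lemma normStirling_zero_succ (k : ℕ) : normStirling 0 (k + 1) = 0 := by
  simp [normStirling]

lemma normStirling_succ_succ (m k : ℕ) :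
    normStirling (m + 1) (k + 1) =
      ((k : ℝ) * normStirling (m + 1) k + normStirling m k) / ((k : ℝ) + 1) := by
  unfold normStirling
  have h1 : (k.factorial : ℝ) ≠ 0 := by positivity
  have h2 : (k : ℝ) + 1 ≠ 0 := by positivity
  rw [Nat.stirlingFirst_succ_succ, Nat.factorial_succ]
  push_cast
  field_simp

/-- A crude bound, chosen because it passes through the recurrence: the factor 2^m turns k·2^(m+1) +
2^m into 2^(m+1)(k + 1/2), and (k + 1/2)/(k + 1) is at most √((k+1)/(k+2)). -/
lemma normStirling_le (m k : ℕ) : normStirling m k ≤ 2 ^ m / Real.sqrt ((k : ℝ) + 1) := by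
  induction k generalizing m with
  | zero =>
    cases m with
    | zero => simp [normStirling_zero_zero]
    | succ m => rw [normStirling_succ_zero]; positivity
  | succ k ih =>
    cases m with
    | zero => rw [normStirling_zero_succ]; positivity
    | succ m =>
      have h1 := ih (m + 1)
      have h2 := ih m
      have hk : (0 : ℝ) ≤ k := Nat.cast_nonneg k
      have hs : 0 < Real.sqrt ((k : ℝ) + 1) := Real.sqrt_pos.2 (by positivity)
      have hs' : 0 < Real.sqrt ((k : ℝ) + 1 + 1) := Real.sqrt_pos.2 (by positivity)
      have key : ((k : ℝ) + 1 / 2) * Real.sqrt ((k : ℝ) + 1 + 1) ≤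
          ((k : ℝ) + 1) * Real.sqrt ((k : ℝ) + 1) := by
        rw [← sq_le_sq₀ (by positivity) (by positivity)]
        rw [mul_pow, mul_pow, Real.sq_sqrt (by positivity), Real.sq_sqrt (by positivity)]
        nlinarith
      rw [normStirling_succ_succ]
      push_cast
      calc ((k : ℝ) * normStirling (m + 1) k + normStirling m k) / ((k : ℝ) + 1)
          ≤ ((k : ℝ) * (2 ^ (m + 1) / Real.sqrt ((k : ℝ) + 1))
              + 2 ^ m / Real.sqrt ((k : ℝ) + 1)) / ((k : ℝ) + 1) := by gcongr
        _ = 2 ^ (m + 1) * (((k : ℝ) + 1 / 2) /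
              (((k : ℝ) + 1) * Real.sqrt ((k : ℝ) + 1))) := by
            rw [pow_succ]; field_simp
        _ ≤ 2 ^ (m + 1) * (1 / Real.sqrt ((k : ℝ) + 1 + 1)) := by
            refine mul_le_mul_of_nonneg_left ?_ (by positivity)
            rw [div_le_div_iff₀ (by positivity) hs', one_mul]
            exact key
        _ = _ := by ring

lemma normStirling_sub_succ (m k : ℕ) :
    normStirling (m + 1) k - normStirling (m + 1) (k + 1) =
      (normStirling (m + 1) k - normStirling m k) / ((k : ℝ) + 1) := by
  have h2 : (k : ℝ) + 1 ≠ 0 := by positivity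
  rw [normStirling_succ_succ]
  field_simp
  ring

/-! ### Shifted harmonic sums and vanishing boundary terms -/

/-- The harmonic-type sum `1 / r + 1 / (r + 1) + ⋯ + 1 / (r + k - 1)`. -/
noncomputable def shiftedHarmonic (r k : ℕ) : ℝ := ∑ i ∈ range k, 1 / ((r : ℝ) + i)

lemma shiftedHarmonic_zero (r : ℕ) : shiftedHarmonic r 0 = 0 := by simp [shiftedHarmonic]

lemma shiftedHarmonic_succ (r k : ℕ) :
    shiftedHarmonic r (k + 1) = shiftedHarmonic r k + 1 / ((r : ℝ) + k) := by
  simp [shiftedHarmonic, sum_range_succ]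

lemma shiftedHarmonic_nonneg (r k : ℕ) : 0 ≤ shiftedHarmonic r k :=
  sum_nonneg fun i _ => by positivity

lemma shiftedHarmonic_succ_left (r k : ℕ) :
    shiftedHarmonic (r + 1) k = shiftedHarmonic r k - 1 / r + 1 / ((r : ℝ) + k) := by
  induction k with
  | zero => simp [shiftedHarmonic]
  | succ k ih =>
    rw [shiftedHarmonic_succ, shiftedHarmonic_succ, ih]
    push_cast
    rw [show (r : ℝ) + 1 + k = r + (k + 1) by ring]
    ring

lemma shiftedHarmonic_le {r : ℕ} (hr : 0 < r) (k : ℕ) :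
    shiftedHarmonic r k ≤ 1 + Real.log ((k : ℝ) + 1) := by
  have h1 : shiftedHarmonic r k ≤ (harmonic k : ℝ) := by
    rw [harmonic]
    push_cast
    refine sum_le_sum fun i _ => ?_
    rw [one_div]
    have : (1 : ℝ) ≤ r := by exact_mod_cast hr
    apply inv_anti₀ (by positivity)
    linarith
  refine h1.trans ((harmonic_le_one_add_log k).trans ?_)
  rcases Nat.eq_zero_or_pos k with rfl | hk
  · simp
  · have : (0 : ℝ) < k := by exact_mod_cast hk
    gcongr
    linarith

lemma tendsto_normStirling_mul_sq_log (m : ℕ) :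
    Tendsto (fun k : ℕ => normStirling m k * (1 + Real.log ((k : ℝ) + 1)) ^ 2) atTop (𝓝 0) := by
  have hcast : Tendsto (fun k : ℕ => (k : ℝ) + 1) atTop atTop :=
    tendsto_atTop_add_const_right _ _ tendsto_natCast_atTop_atTop
  -- The exponent 1/4 is half of the available decay 1/2, since the logarithm is squared.
  have h1 : (fun x : ℝ => (1 + Real.log x)) =o[atTop] fun x => x ^ (1 / 4 : ℝ) := by
    refine Asymptotics.IsLittleO.add ?_ (isLittleO_log_rpow_atTop (by norm_num))
    rw [Asymptotics.isLittleO_const_left]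
    right
    exact tendsto_norm_atTop_atTop.comp (tendsto_rpow_atTop (by norm_num))
  have h2 : Tendsto (fun x : ℝ => (1 + Real.log x) / x ^ (1 / 4 : ℝ)) atTop (𝓝 0) :=
    h1.tendsto_div_nhds_zero
  have h3 : Tendsto (fun k : ℕ => 2 ^ m *
      ((1 + Real.log ((k : ℝ) + 1)) / ((k : ℝ) + 1) ^ (1 / 4 : ℝ)) ^ 2) atTop (𝓝 0) := by
    simpa using ((h2.comp hcast).pow 2).const_mul (2 ^ m : ℝ)
  refine squeeze_zero (fun k => mul_nonneg (normStirling_nonneg m k) (sq_nonneg _))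
    (fun k => ?_) h3
  have hpos : (0 : ℝ) < (k : ℝ) + 1 := by positivity
  have hsq : (((k : ℝ) + 1) ^ (1 / 4 : ℝ)) ^ 2 = Real.sqrt ((k : ℝ) + 1) := by
    rw [Real.sqrt_eq_rpow, ← Real.rpow_natCast, ← Real.rpow_mul hpos.le]
    norm_num
  rw [div_pow, hsq]
  calc _ ≤ 2 ^ m / Real.sqrt ((k : ℝ) + 1) * (1 + Real.log ((k : ℝ) + 1)) ^ 2 := by
        gcongr; exact normStirling_le m k
    _ = _ := by ring

/-- Disposes of the boundary term in every summation by parts over the Stirling index. -/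
lemma tendsto_normStirling_mul_of_abs_le (m : ℕ) {f : ℕ → ℝ}
    (hf : ∀ k, |f k| ≤ (1 + Real.log ((k : ℝ) + 1)) ^ 2) :
    Tendsto (fun k => normStirling m k * f k) atTop (𝓝 0) := by
  refine squeeze_zero_norm (fun k => ?_) (tendsto_normStirling_mul_sq_log m)
  rw [Real.norm_eq_abs, abs_mul, abs_of_nonneg (normStirling_nonneg m k)]
  exact mul_le_mul_of_nonneg_left (hf k) (normStirling_nonneg m k)

lemma one_le_one_add_log_succ (k : ℕ) : 1 ≤ 1 + Real.log ((k : ℝ) + 1) := by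
  have : 0 ≤ Real.log ((k : ℝ) + 1) := Real.log_nonneg (by linarith [Nat.cast_nonneg (α := ℝ) k])
  linarith

/-! ### Zeta values from reciprocal binomials -/

/-- The reciprocal binomial coefficient `k! n! / (k + n)!`. -/
noncomputable def invChoose (k n : ℕ) : ℝ :=
  (k.factorial : ℝ) * n.factorial / (k + n).factorial

lemma invChoose_nonneg (k n : ℕ) : 0 ≤ invChoose k n := by
  unfold invChoose; positivity

lemma invChoose_zero_left (n : ℕ) : invChoose 0 n = 1 := by
  have : (n.factorial : ℝ) ≠ 0 := by positivity
  simp [invChoose, this]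

lemma invChoose_comm (k n : ℕ) : invChoose k n = invChoose n k := by
  unfold invChoose; rw [add_comm k n, mul_comm (k.factorial : ℝ)]

lemma invChoose_succ_left (k n : ℕ) :
    invChoose (k + 1) n = invChoose k n * ((k : ℝ) + 1) / ((k : ℝ) + n + 1) := by
  unfold invChoose
  have h1 : ((k + n).factorial : ℝ) ≠ 0 := by positivity
  have h2 : (k : ℝ) + n + 1 ≠ 0 := by positivity
  rw [show k + 1 + n = (k + n) + 1 by ring, Nat.factorial_succ, Nat.factorial_succ]
  push_cast
  field_simp

lemma invChoose_succ_right (k n : ℕ) :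
    invChoose k (n + 1) = invChoose k n * ((n : ℝ) + 1) / ((k : ℝ) + n + 1) := by
  rw [invChoose_comm, invChoose_succ_left, invChoose_comm, add_comm (n : ℝ) k]

lemma invChoose_antitone_left (n : ℕ) : Antitone fun k => invChoose k n := by
  refine antitone_nat_of_succ_le fun k => ?_
  rw [invChoose_succ_left, mul_div_assoc]
  refine mul_le_of_le_one_right (invChoose_nonneg k n) ?_
  rw [div_le_one (by positivity)]
  linarith [Nat.cast_nonneg (α := ℝ) n]

/-- Telescopes: k times the summand is `invChoose k n - invChoose k (n + 1)`. -/
lemma hasSum_invChoose_div {k : ℕ} (hk : 0 < k) :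
    HasSum (fun n : ℕ => invChoose k n / ((k : ℝ) + n + 1)) (1 / (k : ℝ)) := by
  have hk0 : (k : ℝ) ≠ 0 := by positivity
  rw [hasSum_iff_tendsto_nat_of_nonneg
    (fun n => div_nonneg (invChoose_nonneg k n) (by positivity))]
  have hpart : ∀ N : ℕ, ∑ n ∈ range N, invChoose k n / ((k : ℝ) + n + 1) =
      (1 - invChoose k N) / k := by
    intro N
    induction N with
    | zero => simp [invChoose_comm k 0, invChoose_zero_left]
    | succ N ih =>
      have : (k : ℝ) + N + 1 ≠ 0 := by positivity
      rw [sum_range_succ, ih, invChoose_succ_right]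
      field_simp
      ring
  have hlim : Tendsto (fun N => invChoose k N) atTop (𝓝 0) := by
    refine squeeze_zero (fun N => invChoose_nonneg k N) (fun N => ?_)
      tendsto_one_div_add_atTop_nhds_zero_nat
    refine (invChoose_antitone_left N (Nat.succ_le_of_lt hk)).trans ?_
    simp [invChoose_succ_left, invChoose_zero_left]
  simp_rw [hpart]
  simpa using (hlim.const_sub 1).div_const (k : ℝ)

/-- Analytically, the second factor is the Beta integral of x^k (1-x)^n and ∑ c(k,m) x^k/k! =
(-log(1-x))^m/m!. Here summation by parts in k replaces the integral: each unit of m contributes a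
factor 1/(n+1). -/
lemma hasSum_normStirling_mul_invChoose (m n : ℕ) :
    HasSum (fun k : ℕ => normStirling m k * (invChoose k n / ((k : ℝ) + n + 1)))
      (1 / ((n : ℝ) + 1) ^ (m + 1)) := by
  have hn : (n : ℝ) + 1 ≠ 0 := by positivity
  induction m with
  | zero =>
    convert hasSum_single (f := fun k : ℕ =>
      normStirling 0 k * (invChoose k n / ((k : ℝ) + n + 1))) 0 ?_ using 1
    · simp [normStirling_zero_zero, invChoose_zero_left]
    · intro k hk
      obtain ⟨k, rfl⟩ := Nat.exists_eq_succ_of_ne_zero hk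
      simp [normStirling_zero_succ]
  | succ m ih =>
    rw [hasSum_iff_tendsto_nat_of_nonneg (fun k => mul_nonneg (normStirling_nonneg _ k)
      (div_nonneg (invChoose_nonneg k n) (by positivity)))]
    have hpart : ∀ K : ℕ,
        ∑ k ∈ range K, normStirling (m + 1) k * (invChoose k n / ((k : ℝ) + n + 1)) =
        (∑ k ∈ range K, normStirling m k * (invChoose k n / ((k : ℝ) + n + 1))
          - normStirling (m + 1) K * invChoose K n) / ((n : ℝ) + 1) := by
      intro K
      induction K with
      | zero => simp [normStirling_succ_zero]
      | succ K ih =>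
        have : (K : ℝ) + n + 1 ≠ 0 := by positivity
        have : (K : ℝ) + 1 ≠ 0 := by positivity
        rw [sum_range_succ, sum_range_succ, ih, invChoose_succ_left, normStirling_succ_succ]
        field_simp
        ring
    have hlim : Tendsto (fun K => normStirling (m + 1) K * invChoose K n) atTop (𝓝 0) := by
      refine tendsto_normStirling_mul_of_abs_le _ fun K => ?_
      rw [abs_of_nonneg (invChoose_nonneg K n)]
      have h1 := invChoose_antitone_left n (Nat.zero_le K)
      simp only [invChoose_zero_left] at h1
      exact h1.trans (one_le_pow₀ (one_le_one_add_log_succ K))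
    simp_rw [hpart]
    convert (ih.tendsto_sum_nat.sub hlim).div_const ((n : ℝ) + 1) using 2
    rw [pow_succ _ (m + 1)]
    field_simp
    ring

/-- The value `ζ(p)` as a real series. -/
noncomputable def zetaSeries (p : ℕ) : ℝ := ∑' n : ℕ, 1 / ((n : ℝ) + 1) ^ p

lemma summable_one_div_succ_pow {p : ℕ} (hp : 1 < p) :
    Summable fun n : ℕ => 1 / ((n : ℝ) + 1) ^ p := by
  have := (summable_nat_add_iff 1).2 (Real.summable_one_div_nat_pow.2 hp)
  simpa using this

lemma riemannZeta_natCast_eq_zetaSeries {p : ℕ} (hp : 1 < p) :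
    riemannZeta p = (zetaSeries p : ℂ) := by
  rw [zeta_eq_tsum_one_div_nat_add_one_cpow (by simpa using hp), zetaSeries]
  push_cast
  simp

/-- A nonnegative double series summed both ways: over k first it gives 1/(n+1)^(m+1), over n first
it gives c(k,m)/(k! k). -/
lemma hasSum_normStirling_div {m : ℕ} (hm : 0 < m) :
    HasSum (fun k : ℕ => normStirling m (k + 1) / ((k : ℝ) + 1)) (zetaSeries (m + 1)) := by
  set f : ℕ × ℕ → ℝ :=
    fun p => normStirling m p.2 * (invChoose p.2 p.1 / ((p.2 : ℝ) + p.1 + 1)) with hf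
  have hnn : 0 ≤ f := fun p => mul_nonneg (normStirling_nonneg _ _)
    (div_nonneg (invChoose_nonneg _ _) (by positivity))
  have hrow : ∀ n, HasSum (fun k => f (n, k)) (1 / ((n : ℝ) + 1) ^ (m + 1)) := fun n =>
    hasSum_normStirling_mul_invChoose m n
  have hsum : Summable f := by
    rw [summable_prod_of_nonneg hnn]
    refine ⟨fun n => (hrow n).summable, ?_⟩
    simp_rw [fun n => (hrow n).tsum_eq]
    exact summable_one_div_succ_pow (by omega)
  have htot : ∑' p, f p = zetaSeries (m + 1) := by
    rw [hsum.tsum_prod]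
    simp_rw [fun n => (hrow n).tsum_eq]
    rfl
  have hswap : HasSum (f ∘ Prod.swap) (zetaSeries (m + 1)) := by
    rw [← htot]
    exact (Equiv.prodComm ℕ ℕ).hasSum_iff.2 hsum.hasSum
  have hcol : ∀ k : ℕ, HasSum (fun n => (f ∘ Prod.swap) (k, n)) (normStirling m k * (1 / k)) := by
    intro k
    rcases Nat.eq_zero_or_pos k with rfl | hk
    -- The column k = 0 is zero because m > 0, which agrees with the convention 1/0 = 0.
    · obtain ⟨m, rfl⟩ := Nat.exists_eq_succ_of_ne_zero hm.ne'
      simp [hf, normStirling_succ_zero]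
    · exact (hasSum_invChoose_div hk).mul_left _
  have h := hswap.prod_fiberwise hcol
  rw [← hasSum_nat_add_iff' 1] at h
  simpa [div_eq_mul_inv] using h

/-! ### The series with a single harmonic factor -/

/-- The summand `c(k, m) / k! · (1 / r + ⋯ + 1 / (r + k - 1)) / (k + r)`. -/
noncomputable def harmonicTerm (r m k : ℕ) : ℝ :=
  normStirling m k * shiftedHarmonic r k / ((k : ℝ) + r)

lemma harmonicTerm_nonneg (r m k : ℕ) : 0 ≤ harmonicTerm r m k :=
  div_nonneg (mul_nonneg (normStirling_nonneg _ _) (shiftedHarmonic_nonneg _ _)) (by positivity)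

lemma harmonicTerm_zero (r k : ℕ) : harmonicTerm r 0 k = 0 := by
  cases k with
  | zero => simp [harmonicTerm, shiftedHarmonic_zero]
  | succ k => simp [harmonicTerm, normStirling_zero_succ]

lemma abs_shiftedHarmonic_le {r : ℕ} (hr : 0 < r) (k : ℕ) :
    |shiftedHarmonic r k| ≤ (1 + Real.log ((k : ℝ) + 1)) ^ 2 := by
  rw [abs_of_nonneg (shiftedHarmonic_nonneg r k)]
  have h := one_le_one_add_log_succ k
  exact (shiftedHarmonic_le hr k).trans (le_self_pow₀ h two_ne_zero)

lemma sum_harmonicTerm_one (m K : ℕ) :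
    ∑ k ∈ range K, harmonicTerm 1 (m + 1) k = ∑ k ∈ range K, harmonicTerm 1 m k +
      ∑ k ∈ range K, normStirling (m + 1) (k + 1) / ((k : ℝ) + 1)
        - normStirling (m + 1) K * shiftedHarmonic 1 K := by
  induction K with
  | zero => simp [shiftedHarmonic_zero]
  | succ K ih =>
    have h1 : (K : ℝ) + 1 ≠ 0 := by positivity
    have h2 : (1 : ℝ) + K ≠ 0 := by positivity
    have step : harmonicTerm 1 (m + 1) K = harmonicTerm 1 m K +
        normStirling (m + 1) (K + 1) / ((K : ℝ) + 1)
          - normStirling (m + 1) (K + 1) * shiftedHarmonic 1 (K + 1)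
          + normStirling (m + 1) K * shiftedHarmonic 1 K := by
      simp only [harmonicTerm, shiftedHarmonic_succ, normStirling_succ_succ]
      push_cast
      field_simp
      ring
    simp only [sum_range_succ]
    linear_combination ih + step

/-- Summation by parts against (e₁ - 1/r)·k/(k+r), with e₁ = `shiftedHarmonic r k`; this weight
links the summands for r and r + 1. -/
lemma sum_harmonicTerm_succ {r : ℕ} (hr : 0 < r) (m K : ℕ) :
    ∑ k ∈ range K, harmonicTerm (r + 1) (m + 1) k = (∑ k ∈ range K, harmonicTerm (r + 1) m k +
      r * ∑ k ∈ range K, harmonicTerm r (m + 1) k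
        - normStirling (m + 1) K *
          ((shiftedHarmonic r K - 1 / r) * (K / ((K : ℝ) + r)))) / ((r : ℝ) + 1) := by
  have hr0 : (r : ℝ) ≠ 0 := by positivity
  have hr1 : (r : ℝ) + 1 ≠ 0 := by positivity
  rw [eq_div_iff hr1]
  induction K with
  | zero => simp [normStirling_succ_zero]
  | succ K ih =>
    have h1 : (K : ℝ) + 1 ≠ 0 := by positivity
    have h2 : (K : ℝ) + r ≠ 0 := by positivity
    have h3 : (K : ℝ) + 1 + r ≠ 0 := by positivity
    have step : harmonicTerm (r + 1) (m + 1) K * ((r : ℝ) + 1) = harmonicTerm (r + 1) m K +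
        r * harmonicTerm r (m + 1) K
          - normStirling (m + 1) (K + 1) *
            ((shiftedHarmonic r (K + 1) - 1 / r) * (((K + 1 : ℕ) : ℝ) / (((K + 1 : ℕ) : ℝ) + r)))
          + normStirling (m + 1) K *
            ((shiftedHarmonic r K - 1 / r) * (K / ((K : ℝ) + r))) := by
      simp only [harmonicTerm, shiftedHarmonic_succ_left, shiftedHarmonic_succ,
        normStirling_succ_succ]
      push_cast
      rw [show (r : ℝ) + K = K + r by ring, show (K : ℝ) + (r + 1) = K + 1 + r by ring]
      field_simp
      ring
    simp only [sum_range_succ]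
    linear_combination ih + step

/-- The alternating sum `-∑_{j=1}^r (r choose j) (-1) ^ j / j ^ k`. -/
noncomputable def alternatingCoeff (k r : ℕ) : ℝ :=
  -∑ j ∈ Icc 1 r, (r.choose j : ℝ) * ((-1) ^ j / (j : ℝ) ^ k)

lemma alternatingCoeff_zero {r : ℕ} (hr : 0 < r) : alternatingCoeff 0 r = 1 := by
  have h : ∑ j ∈ range (r + 1), ((-1) ^ j * (r.choose j) : ℤ) = 0 :=
    Int.alternating_sum_range_choose_of_ne hr.ne'
  have h' : ∑ j ∈ range (r + 1), (r.choose j : ℝ) * (-1) ^ j = 0 := by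
    have : ((∑ j ∈ range (r + 1), ((-1) ^ j * (r.choose j) : ℤ) : ℤ) : ℝ) = 0 := by
      rw [h]; simp
    push_cast at this
    rw [← this]
    exact sum_congr rfl fun j _ => mul_comm _ _
  rw [sum_range_eq_add_Ico _ (Nat.succ_pos r)] at h'
  have hI : Icc 1 r = Ico 1 (r + 1) := by ext; simp
  simp only [alternatingCoeff, pow_zero, div_one, hI]
  simp at h'
  linarith

lemma alternatingCoeff_one (k : ℕ) : alternatingCoeff k 1 = 1 := by
  simp [alternatingCoeff]

/-- Termwise this is C(r,j) = C(r+1,j)(1 - j/(r+1)); the sum for r may be extended to j = r + 1,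
where C(r,j) = 0. -/
lemma alternatingCoeff_succ (k r : ℕ) :
    alternatingCoeff (k + 1) (r + 1) =
      alternatingCoeff k (r + 1) / ((r : ℝ) + 1) + alternatingCoeff (k + 1) r := by
  have hr1 : (r : ℝ) + 1 ≠ 0 := by positivity
  have hext : ∑ j ∈ Icc 1 r, (r.choose j : ℝ) * ((-1) ^ j / (j : ℝ) ^ (k + 1)) =
      ∑ j ∈ Icc 1 (r + 1), (r.choose j : ℝ) * ((-1) ^ j / (j : ℝ) ^ (k + 1)) := by
    rw [sum_Icc_succ_top (by omega)]
    simp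
  unfold alternatingCoeff
  rw [hext, neg_div, ← neg_add, sum_div, ← sum_add_distrib]
  congr 1
  refine sum_congr rfl fun j hj => ?_
  have hj1 : 1 ≤ j := (mem_Icc.1 hj).1
  have hj2 : j ≤ r + 1 := (mem_Icc.1 hj).2
  have hj0 : (j : ℝ) ≠ 0 := by positivity
  have hc : ((r + 1).choose j : ℝ) * ((r : ℝ) + 1 - j) = (r.choose j : ℝ) * ((r : ℝ) + 1) := by
    have h := Nat.choose_mul_succ_eq r j
    have h' : ((r.choose j * (r + 1) : ℕ) : ℝ) = (((r + 1).choose j * (r + 1 - j) : ℕ) : ℝ) := by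
      rw [h]
    rw [Nat.cast_mul, Nat.cast_mul, Nat.cast_sub hj2] at h'
    push_cast at h'
    exact h'.symm
  rw [pow_succ (j : ℝ) k]
  field_simp
  linear_combination hc

/-- The closed form of `∑ k, harmonicTerm r m k`. -/
noncomputable def harmonicValue (r m : ℕ) : ℝ :=
  1 / (r : ℝ) * ∑ k ∈ range m, alternatingCoeff k r * zetaSeries (m - k + 1)

lemma harmonicValue_one_succ (m : ℕ) :
    harmonicValue 1 (m + 1) = harmonicValue 1 m + zetaSeries (m + 2) := by
  simp [harmonicValue, alternatingCoeff_one, sum_range_succ']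

lemma harmonicValue_succ {r : ℕ} (hr : 0 < r) (m : ℕ) :
    harmonicValue (r + 1) (m + 1) =
      (harmonicValue (r + 1) m + r * harmonicValue r (m + 1)) / ((r : ℝ) + 1) := by
  have hr0 : (r : ℝ) ≠ 0 := by positivity
  have hr1 : (r : ℝ) + 1 ≠ 0 := by positivity
  unfold harmonicValue
  simp only [sum_range_succ', alternatingCoeff_zero hr, alternatingCoeff_zero (Nat.succ_pos r),
    alternatingCoeff_succ, add_mul, sum_add_distrib, Nat.add_sub_add_right, div_mul_eq_mul_div,
    ← sum_div]
  push_cast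
  field_simp
  ring

lemma hasSum_harmonicTerm_one (m : ℕ) :
    HasSum (fun k => harmonicTerm 1 m k) (harmonicValue 1 m) := by
  induction m with
  | zero => simp [harmonicTerm_zero, harmonicValue]
  | succ m ih =>
    rw [hasSum_iff_tendsto_nat_of_nonneg (harmonicTerm_nonneg 1 _)]
    simp_rw [sum_harmonicTerm_one, harmonicValue_one_succ]
    simpa using (ih.tendsto_sum_nat.add
      (hasSum_normStirling_div (Nat.succ_pos m)).tendsto_sum_nat).sub
        (tendsto_normStirling_mul_of_abs_le (m + 1) (abs_shiftedHarmonic_le one_pos))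

/-- Induction on r for all m at once, with an inner induction on m, as the recurrence calls on both
(r+1, m) and (r, m+1). -/
lemma hasSum_harmonicTerm {r : ℕ} (hr : 0 < r) (m : ℕ) :
    HasSum (fun k => harmonicTerm r m k) (harmonicValue r m) := by
  induction r, hr using Nat.le_induction generalizing m with
  | base => exact hasSum_harmonicTerm_one m
  | succ r hr ihr =>
    induction m with
    | zero => simp [harmonicTerm_zero, harmonicValue]
    | succ m ih =>
      have hr' : 0 < r := hr
      rw [hasSum_iff_tendsto_nat_of_nonneg (harmonicTerm_nonneg _ _)]
      simp_rw [sum_harmonicTerm_succ hr', harmonicValue_succ hr']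
      have hb : ∀ K : ℕ, |(shiftedHarmonic r K - 1 / r) * (K / ((K : ℝ) + r))| ≤
          (1 + Real.log ((K : ℝ) + 1)) ^ 2 := by
        intro K
        have hr1 : (1 : ℝ) ≤ r := by exact_mod_cast hr
        have h1 := one_le_one_add_log_succ K
        have h2 := shiftedHarmonic_le hr' K
        have h3 := shiftedHarmonic_nonneg r K
        have h4 : (1 : ℝ) / r ≤ 1 := by rw [div_le_one (by positivity)]; exact hr1
        have h5 : (0 : ℝ) ≤ 1 / r := by positivity
        have h6 : (K : ℝ) / ((K : ℝ) + r) ≤ 1 := by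
          rw [div_le_one (by positivity)]; linarith
        rw [abs_mul, abs_of_nonneg (show (0 : ℝ) ≤ K / ((K : ℝ) + r) by positivity)]
        refine (mul_le_of_le_one_right (abs_nonneg _) h6).trans ?_
        refine le_trans ?_ (le_self_pow₀ h1 two_ne_zero)
        rw [abs_le]
        constructor <;> linarith
      simpa using ((ih.tendsto_sum_nat.add ((ihr (m + 1)).tendsto_sum_nat.const_mul (r : ℝ))).sub
        (tendsto_normStirling_mul_of_abs_le (m + 1) hb)).div_const ((r : ℝ) + 1)

/-! ### The series with the second symmetric function -/

/-- The second elementary symmetric function of `1 / r, …, 1 / (r + n)`, through power sums. -/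
noncomputable def harmonicPair (r n : ℕ) : ℝ :=
  ((genHarmonic 1 (n + r) - genHarmonic 1 (r - 1)) ^ 2
      - (genHarmonic 2 (n + r) - genHarmonic 2 (r - 1))) / 2

lemma genHarmonic_succ (p n : ℕ) :
    genHarmonic p (n + 1) = genHarmonic p n + 1 / ((n : ℝ) + 1) ^ p := by
  unfold genHarmonic
  rw [sum_Icc_succ_top (by omega)]
  push_cast
  rfl

lemma genHarmonic_one_sub (r n : ℕ) (hr : 0 < r) :
    genHarmonic 1 (n + r) - genHarmonic 1 (r - 1) = shiftedHarmonic r (n + 1) := by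
  obtain ⟨r, rfl⟩ := Nat.exists_eq_succ_of_ne_zero hr.ne'
  induction n with
  | zero => simp [shiftedHarmonic, genHarmonic_succ]
  | succ n ih =>
    rw [shiftedHarmonic_succ, ← ih, show n + 1 + r.succ = (n + r.succ) + 1 by ring,
      genHarmonic_succ]
    push_cast
    rw [show (n : ℝ) + (r + 1) + 1 = r + 1 + (n + 1) by ring]
    ring

lemma harmonicPair_zero {r : ℕ} (hr : 0 < r) : harmonicPair r 0 = 0 := by
  obtain ⟨r, rfl⟩ := Nat.exists_eq_succ_of_ne_zero hr.ne'
  simp [harmonicPair, genHarmonic_succ]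

/-- Adjoining a variable x to e₂ adds x·e₁ of the old variables. -/
lemma harmonicPair_succ {r : ℕ} (hr : 0 < r) (n : ℕ) :
    harmonicPair r (n + 1) =
      harmonicPair r n + shiftedHarmonic r (n + 1) / ((n : ℝ) + 1 + r) := by
  have h : (n : ℝ) + 1 + r ≠ 0 := by positivity
  unfold harmonicPair
  rw [genHarmonic_one_sub r _ hr, genHarmonic_one_sub r _ hr, shiftedHarmonic_succ r (n + 1),
    show n + 1 + r = (n + r) + 1 by ring, genHarmonic_succ]
  push_cast
  rw [show (r : ℝ) + (n + 1) = n + 1 + r by ring, show (n : ℝ) + r + 1 = n + 1 + r by ring]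
  field_simp
  ring

lemma harmonicPair_nonneg {r : ℕ} (hr : 0 < r) (n : ℕ) : 0 ≤ harmonicPair r n := by
  induction n with
  | zero => rw [harmonicPair_zero hr]
  | succ n ih =>
    rw [harmonicPair_succ hr]
    have := shiftedHarmonic_nonneg r (n + 1)
    positivity

/-- With e₁ = `shiftedHarmonic r n` and q = 1/(r+n), the left side grows by at most (e₁ + q)q, the
right side by (2e₁ + q)q. -/
lemma harmonicPair_le_sq {r : ℕ} (hr : 0 < r) (n : ℕ) :
    harmonicPair r n ≤ shiftedHarmonic r n ^ 2 := by
  induction n with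
  | zero => rw [harmonicPair_zero hr]; positivity
  | succ n ih =>
    have h0 := shiftedHarmonic_nonneg r n
    have hn : (0 : ℝ) < r + n := by positivity
    have hq : 0 ≤ 1 / ((r : ℝ) + n) := by positivity
    have hle : shiftedHarmonic r (n + 1) / ((n : ℝ) + 1 + r) ≤
        shiftedHarmonic r (n + 1) * (1 / ((r : ℝ) + n)) := by
      rw [div_eq_mul_one_div]
      refine mul_le_mul_of_nonneg_left ?_ (shiftedHarmonic_nonneg _ _)
      apply one_div_le_one_div_of_le hn
      linarith
    rw [harmonicPair_succ hr]
    rw [shiftedHarmonic_succ] at hle ⊢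
    nlinarith [mul_nonneg h0 hq]

/-- The summand `c(n, m) / (n + 1)! · e₂(1 / r, …, 1 / (r + n))`. -/
noncomputable def pairTerm (r m n : ℕ) : ℝ :=
  normStirling m n * harmonicPair r n / ((n : ℝ) + 1)

lemma pairTerm_nonneg {r : ℕ} (hr : 0 < r) (m n : ℕ) : 0 ≤ pairTerm r m n :=
  div_nonneg (mul_nonneg (normStirling_nonneg m n) (harmonicPair_nonneg hr n)) (by positivity)

/-- Summation by parts: the increment of e₂ produces `harmonicTerm` at index n + 1, hence the range
K + 1; the extra term at 0 vanishes. -/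
lemma sum_pairTerm_succ {r : ℕ} (hr : 0 < r) (m K : ℕ) :
    ∑ n ∈ range K, pairTerm r (m + 1) n = ∑ n ∈ range K, pairTerm r m n +
      ∑ k ∈ range (K + 1), harmonicTerm r (m + 1) k
        - normStirling (m + 1) K * harmonicPair r K := by
  induction K with
  | zero => simp [normStirling_succ_zero, harmonicTerm]
  | succ K ih =>
    have h1 : (K : ℝ) + 1 ≠ 0 := by positivity
    have h3 : (K : ℝ) + 1 + r ≠ 0 := by positivity
    have hd := normStirling_sub_succ m K
    have hd' : (normStirling (m + 1) K - normStirling m K) =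
      (normStirling (m + 1) K - normStirling (m + 1) (K + 1)) * ((K : ℝ) + 1) := by
      rw [hd]; field_simp
    rw [sum_range_succ, sum_range_succ _ K, sum_range_succ _ (K + 1), ih, harmonicPair_succ hr]
    simp only [pairTerm, harmonicTerm]
    push_cast
    field_simp
    linear_combination ((K : ℝ) + 1 + r) * harmonicPair r K * hd'

lemma coeffA_zero (r : ℕ) : coeffA 0 r = 1 := by simp [coeffA]

lemma coeffA_succ (k r : ℕ) : coeffA (k + 1) r = coeffA k r + alternatingCoeff (k + 1) r := by
  have hf : (r.factorial : ℝ) ≠ 0 := by positivity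
  have hs : ((-1 : ℝ) ^ r) * (-1) ^ r = 1 := by rw [← mul_pow]; simp
  unfold coeffA alternatingCoeff
  rw [sum_Icc_succ_top (by omega), stirlingSecondNeg, pow_succ (-1 : ℝ) r]
  field_simp
  linear_combination
    (-∑ j ∈ Icc 1 r, (r.choose j : ℝ) * (-1) ^ j / (j : ℝ) ^ (k + 1)) * hs

/-- The closed form of `∑ n, pairTerm r m n`. -/
noncomputable def pairValue (r m : ℕ) : ℝ :=
  1 / (r : ℝ) * ∑ k ∈ range m, coeffA k r * zetaSeries (m - k + 1)

lemma pairValue_succ {r : ℕ} (hr : 0 < r) (m : ℕ) :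
    pairValue r (m + 1) = pairValue r m + harmonicValue r (m + 1) := by
  unfold pairValue harmonicValue
  rw [← mul_add, sum_range_succ', sum_range_succ']
  simp only [coeffA_zero, alternatingCoeff_zero hr, coeffA_succ, add_mul, sum_add_distrib,
    Nat.add_sub_add_right]
  ring

lemma hasSum_pairTerm {r : ℕ} (hr : 0 < r) (m : ℕ) :
    HasSum (fun n => pairTerm r m n) (pairValue r m) := by
  induction m with
  | zero =>
    have h : ∀ n, pairTerm r 0 n = 0 := by
      intro n
      cases n with
      | zero => simp [pairTerm, harmonicPair_zero hr]
      | succ n => simp [pairTerm, normStirling_zero_succ]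
    simp [h, pairValue]
  | succ m ih =>
    rw [hasSum_iff_tendsto_nat_of_nonneg (pairTerm_nonneg hr _)]
    simp_rw [sum_pairTerm_succ hr, pairValue_succ hr]
    have hb : ∀ K : ℕ, |harmonicPair r K| ≤ (1 + Real.log ((K : ℝ) + 1)) ^ 2 := by
      intro K
      rw [abs_of_nonneg (harmonicPair_nonneg hr K)]
      refine (harmonicPair_le_sq hr K).trans ?_
      gcongr
      · exact shiftedHarmonic_nonneg r K
      · exact shiftedHarmonic_le hr K
    simpa using (ih.tendsto_sum_nat.add
      ((hasSum_harmonicTerm hr (m + 1)).tendsto_sum_nat.comp (tendsto_add_atTop_nat 1))).sub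
        (tendsto_normStirling_mul_of_abs_le (m + 1) hb)

/-! ### Signs, and passage to the stated series -/

lemma stirlingFirstSigned_eq (n k : ℕ) :
    stirlingFirstSigned n k = (-1) ^ (n + k) * (Nat.stirlingFirst n k : ℤ) := by
  unfold stirlingFirstSigned
  induction n generalizing k with
  | zero =>
    cases k with
    | zero => simp
    | succ k => simp [Polynomial.coeff_one]
  | succ n ih =>
    have hn : (n : Polynomial ℤ) = Polynomial.C (n : ℤ) := by simp
    rw [descPochhammer_succ_right, mul_sub, hn, Polynomial.coeff_sub, Polynomial.coeff_mul_C]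
    cases k with
    | zero =>
      rw [Polynomial.coeff_mul_X_zero, ih]
      cases n <;> simp
    | succ k =>
      rw [Polynomial.coeff_mul_X, ih, ih, Nat.stirlingFirst_succ_succ]
      push_cast
      ring

lemma stirlingHarmonicTerm_eq_pairTerm {m n : ℕ} (h : m ≤ n) (r : ℕ) :
    stirlingHarmonicTerm r m n = pairTerm r m n := by
  have hs : (-1 : ℝ) ^ (n - m) * (-1) ^ (n + m) = 1 := by
    rw [← pow_add, show n - m + (n + m) = 2 * n by omega, pow_mul]
    simp
  have hf : (n.factorial : ℝ) ≠ 0 := by positivity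
  have h1 : (n : ℝ) + 1 ≠ 0 := by positivity
  unfold stirlingHarmonicTerm pairTerm harmonicPair normStirling
  rw [stirlingFirstSigned_eq, Nat.factorial_succ]
  push_cast
  rw [← mul_assoc ((-1 : ℝ) ^ (n - m)), hs]
  field_simp

theorem mainTheorem11 (r m : ℕ) (hr : 1 ≤ r) (hm : 1 ≤ m) :
    HasSum (fun n : {n : ℕ // m ≤ n} => ((stirlingHarmonicTerm r m n : ℝ) : ℂ))
      ((1 / (r : ℂ)) *
        ∑ k ∈ Finset.range m, ((coeffA k r : ℝ) : ℂ) * riemannZeta ((m : ℂ) - (k : ℂ) + 1)) := by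
  have hval : (1 / (r : ℂ)) * ∑ k ∈ Finset.range m,
      ((coeffA k r : ℝ) : ℂ) * riemannZeta ((m : ℂ) - (k : ℂ) + 1) = (pairValue r m : ℂ) := by
    unfold pairValue
    push_cast
    congr 1
    refine sum_congr rfl fun k hk => ?_
    have hk' : k < m := mem_range.1 hk
    rw [← riemannZeta_natCast_eq_zetaSeries (by omega), Nat.cast_add, Nat.cast_sub hk'.le,
      Nat.cast_one]
  rw [hval]
  -- Since c(n,m) = 0 for n < m, the sum over all n equals the sum over n ≥ m, where n - m is a true
  -- difference.
  have hsupp : Function.support (fun n => pairTerm r m n) ⊆ {n | m ≤ n} := by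
    intro n hn
    by_contra hlt
    refine hn ?_
    have : Nat.stirlingFirst n m = 0 := Nat.stirlingFirst_eq_zero_of_lt (not_le.1 hlt)
    simp [pairTerm, normStirling, this]
  have h : HasSum (fun n : {n : ℕ // m ≤ n} => pairTerm r m n) (pairValue r m) :=
    (hasSum_subtype_iff_of_support_subset hsupp).2 (hasSum_pairTerm hr m)
  have hc := Complex.hasSum_ofReal.2 h
  convert hc using 2 with n
  rw [stirlingHarmonicTerm_eq_pairTerm n.2]
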